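/- Let $n\ge 0$ be an integer and let $h$ be a positive definite hermitian $n\times n$ matrix, defining the scalar product $(v,u)=v^\dagger h\,u$ on $\mathbb C^n$. Let $M$ be a Riemann surface, let $G^{k}(\mathbb C^n)$ be the Grassmann manifold of $k$-dimensional subspaces of $\mathbb C^n$, and let $\psi:M\to G^{k}(\mathbb C^n)$ be a holomorphic curve. Let $U\subset M$ be open and contained in the domain of a local holomorphic coordinate $z$ of $M$. Write $\partial_-=\partial/\partial z$ and $\partial_+=\partial/\partial\bar z$, applied to matrix-valued functions entrywise. Let $\xi$ be a holomorphic lift of $\psi$ over $U$, that is, a holomorphic function on $U$ with values in the complex $n\times k$ matrices of rank $k$ such that the columns of $\xi(p)$ span $\psi(p)$ for every $p\in U$. An osculating sequence of $\xi$ consists of an integer $t\ge 0$, integers $k_0=k$ and $k_1,\dots,k_t>0$, holomorphic functions $\xi_0=\xi,\xi_1,\dots,\xi_t$ on $U$, where $\xi_a$ has values in the complex $n\times k_a$ matrices, and holomorphic functions $B_{ba}$ on $U$ ($0\le a\le t$, $0\le b\le \min(a+1,t)$) with values in the complex $k_b\times k_a$ matrices, such that for $0\le a\le t$: (i) the matrix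 $(\xi_0\,\xi_1\cdots\xi_a)$ has rank $k_0+\dots+k_a$ at every point of $U$; (ii) the maximum over $U$ of the rank of $(\xi_0\cdots\xi_a\;\,\partial_-\xi_a)$ is $k_0+\dots+k_{\min(a+1,t)}$; (iii) $\partial_-\xi_a=\sum_{b=0}^{\min(a+1,t)}\xi_b\,B_{ba}$. Given an osculating sequence of $\xi$, define inductively, for $a=0,\dots,t$, $$\varphi_0=\xi_0,\qquad \varphi_{a}=\Pi_{a-1}\cdots\Pi_0\,\xi_{a}\ (a\ge 1),\qquad \beta_a=\varphi_a^\dagger\,h\,\varphi_a,\qquad \Pi_a=I_n-\varphi_a\beta_a^{-1}\varphi_a^\dagger h .$$ Theorem. For every osculating sequence of $\xi$ and all $a=0,\dots,t$, the functions $\varphi_a$ and $\beta_a$ are smooth on $U$, the matrix $\beta_a$ is invertible at every point of $U$, and on $U$ $$\partial_-\varphi_a=\varphi_a\,\beta_a^{-1}\,\partial_-\beta_a+\varphi_{a+1}\,B_{a+1,a},\qquad \partial_+\varphi_a=\varphi_{a-1}\,\beta_{a-1}^{-1}\,D_{a-1,a}\,\beta_a,$$ where $D_{a-1,a}=-(B_{a,a-1})^\dagger$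 for $1\le a\le t$, the term $\varphi_{a+1}B_{a+1,a}$ is absent for $a=t$, and the right-hand side of the second equation is $0$ for $a=0$. -/

import Mathlib

open scoped Manifold ContDiff Matrix ComplexOrder

noncomputable section

namespace FrenetFrame

section Wirtinger

variable {M : Type*} [TopologicalSpace M]

/-- `∂_- f = ∂f/∂z = (∂f/∂x - i ∂f/∂y) / 2` for a complex function `f` on a Riemann surface and a
local coordinate `z = x + i y`; the value at `p` is meaningful for `p` in the domain of `z`. -/
def dMinus (z : OpenPartialHomeomorph M ℂ) (f : M → ℂ) (p : M) : ℂ :=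
  (fderiv ℝ (fun w : ℂ => f (z.symm w)) (z p) 1
    - Complex.I * fderiv ℝ (fun w : ℂ => f (z.symm w)) (z p) Complex.I) / 2

/-- `∂_+ f = ∂f/∂z̄ = (∂f/∂x + i ∂f/∂y) / 2`. -/
def dPlus (z : OpenPartialHomeomorph M ℂ) (f : M → ℂ) (p : M) : ℂ :=
  (fderiv ℝ (fun w : ℂ => f (z.symm w)) (z p) 1
    + Complex.I * fderiv ℝ (fun w : ℂ => f (z.symm w)) (z p) Complex.I) / 2

/-- Entrywise `∂_-` of a matrix-valued function. -/
def matDMinus {m l : ℕ} (z : OpenPartialHomeomorph M ℂ) (X : M → Matrix (Fin m) (Fin l) ℂ)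
    (p : M) : Matrix (Fin m) (Fin l) ℂ :=
  Matrix.of fun i j => dMinus z (fun q => X q i j) p

/-- Entrywise `∂_+` of a matrix-valued function. -/
def matDPlus {m l : ℕ} (z : OpenPartialHomeomorph M ℂ) (X : M → Matrix (Fin m) (Fin l) ℂ)
    (p : M) : Matrix (Fin m) (Fin l) ℂ :=
  Matrix.of fun i j => dPlus z (fun q => X q i j) p

/-- All entries of `X` are smooth functions (in the sense of real analysis) of the local
coordinate `z` on `U`. -/
def SmoothInCoord {m l : ℕ} (z : OpenPartialHomeomorph M ℂ) (U : Set M)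
    (X : M → Matrix (Fin m) (Fin l) ℂ) : Prop :=
  ∀ i j, ContDiffOn ℝ ∞ (fun w : ℂ => X (z.symm w) i j) (z '' U)

end Wirtinger

section Curves

variable {M : Type*} [TopologicalSpace M] [ChartedSpace ℂ M]

/-- A matrix-valued function on a Riemann surface is holomorphic on `U` if its entries are. -/
def HolomorphicOn {m l : ℕ} (X : M → Matrix (Fin m) (Fin l) ℂ) (U : Set M) : Prop :=
  ∀ i j, MDifferentiableOn 𝓘(ℂ) 𝓘(ℂ) (fun p => X p i j) U

/-- The complex Grassmann manifold `G^k(ℂⁿ)` as the set of `k`-dimensional subspaces of `ℂⁿ`. -/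
def Grassmann (n k : ℕ) : Type :=
  {W : Submodule ℂ (Fin n → ℂ) // Module.finrank ℂ W = k}

/-- `ξ` is a holomorphic lift of `ψ` over `U`: on `U` it is holomorphic with values in the
`n × k` matrices of rank `k`, and the columns of `ξ p` span (hence form a basis of) `ψ p`. -/
structure IsHolomorphicLift {n k : ℕ} (ψ : M → Grassmann n k) (U : Set M)
    (ξ : M → Matrix (Fin n) (Fin k) ℂ) : Prop where
  holomorphic : HolomorphicOn ξ U
  rank_eq : ∀ p ∈ U, (ξ p).rank = k
  span_eq : ∀ p ∈ U, Submodule.span ℂ (Set.range (ξ p).col) = (ψ p).1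

/-- Holomorphy of a curve in `G^k(ℂⁿ)` for the complex structure that makes the projection from
the `n × k` matrices of rank `k` a holomorphic principal bundle: a map is holomorphic if and only
if it has holomorphic lifts locally. -/
def IsHolomorphicCurve {n k : ℕ} (ψ : M → Grassmann n k) : Prop :=
  ∀ p : M, ∃ V : Set M, IsOpen V ∧ p ∈ V ∧
    ∃ η : M → Matrix (Fin n) (Fin k) ℂ, IsHolomorphicLift ψ V η

/-- The rank of a matrix-valued function on `U`: the maximum over `p ∈ U` of the rank of `X p`. -/
def rankOn {n : ℕ} {ι : Type} [Fintype ι] (X : M → Matrix (Fin n) ι ℂ) (U : Set M) : ℕ :=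
  sSup ((fun p => (X p).rank) '' U)

/-- The block matrix `(ξ_0 ξ_1 ⋯ ξ_a)`. -/
def blockRow {n : ℕ} {k : ℕ → ℕ} (ξ : ∀ a : ℕ, M → Matrix (Fin n) (Fin (k a)) ℂ) (a : ℕ)
    (p : M) : Matrix (Fin n) ((b : Fin (a + 1)) × Fin (k b)) ℂ :=
  Matrix.of fun i j => ξ j.1 p i j.2

/-- `ξ_0, …, ξ_t` is an osculating sequence on `U`, with block sizes `k_0, …, k_t` and coefficient
functions `B_{ba}`, `0 ≤ b ≤ min (a + 1) t`, relative to the local coordinate `z`.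

At step `a`, the function `(ξ_0 ⋯ ξ_a ∂_-ξ_a)` has rank `k_0 + ⋯ + k_{a+1}`.  As long as `k_{a+1}`
is positive one chooses a holomorphic `ξ_{a+1}` with `k_{a+1}` columns such that
`(ξ_0 ⋯ ξ_{a+1})` is of constant rank `k_0 + ⋯ + k_{a+1}` and
`∂_-ξ_a = ∑_{b ≤ a+1} ξ_b B_{ba}` with holomorphic `B_{ba}`.  At `a = t` the rank no longer grows,
and no term with `b = t + 1` is present. The members with an index above `t` play no role. -/
structure IsOsculatingSequence {n : ℕ} (z : OpenPartialHomeomorph M ℂ) (U : Set M) (t : ℕ)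
    (k : ℕ → ℕ) (ξ : ∀ a : ℕ, M → Matrix (Fin n) (Fin (k a)) ℂ)
    (B : ∀ b a : ℕ, M → Matrix (Fin (k b)) (Fin (k a)) ℂ) : Prop where
  holomorphic : ∀ a ≤ t, HolomorphicOn (ξ a) U
  size_pos : ∀ a, 1 ≤ a → a ≤ t → 0 < k a
  constant_rank : ∀ a ≤ t, ∀ p ∈ U,
    (blockRow ξ a p).rank = ∑ b ∈ Finset.range (a + 1), k b
  rank_next : ∀ a ≤ t,
    rankOn (fun p => Matrix.fromCols (blockRow ξ a p) (matDMinus z (ξ a) p)) U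
      = ∑ b ∈ Finset.range (t + 1) with b ≤ a + 1, k b
  coeff_holomorphic : ∀ a ≤ t, ∀ b ≤ t, b ≤ a + 1 → HolomorphicOn (B b a) U
  derivative : ∀ a ≤ t, ∀ p ∈ U,
    matDMinus z (ξ a) p = ∑ b ∈ Finset.range (t + 1) with b ≤ a + 1, ξ b p * B b a p

end Curves

section Frame

/-- `I_n - X (X† h X)⁻¹ X† h`: for `X` of full column rank, the matrix of the projection along the
column space of `X` onto its orthogonal complement for the scalar product `(v, u) = v† h u`. -/
def projector {n m : ℕ} (h : Matrix (Fin n) (Fin n) ℂ) (X : Matrix (Fin n) (Fin m) ℂ) :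
    Matrix (Fin n) (Fin n) ℂ :=
  1 - X * (Xᴴ * h * X)⁻¹ * Xᴴ * h

variable {n : ℕ} {k : ℕ → ℕ}

/-- The product `Π_{a-1} ⋯ Π_0` (the unit matrix for `a = 0`), where `Π_b` is the projector of the
block `φ_b = Π_{b-1} ⋯ Π_0 ξ_b`. -/
def projProd (h : Matrix (Fin n) (Fin n) ℂ) (ξ : ∀ a : ℕ, Matrix (Fin n) (Fin (k a)) ℂ) :
    ℕ → Matrix (Fin n) (Fin n) ℂ
  | 0 => 1
  | a + 1 => projector h (projProd h ξ a * ξ a) * projProd h ξ a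

variable {M : Type*}

/-- The block `φ_a = Π_{a-1} ⋯ Π_0 ξ_a` of the Frenet frame. -/
def frenet (h : Matrix (Fin n) (Fin n) ℂ) (ξ : ∀ a : ℕ, M → Matrix (Fin n) (Fin (k a)) ℂ)
    (a : ℕ) (p : M) : Matrix (Fin n) (Fin (k a)) ℂ :=
  projProd h (fun b => ξ b p) a * ξ a p

/-- `β_a = φ_a† h φ_a`. -/
def gram (h : Matrix (Fin n) (Fin n) ℂ) (ξ : ∀ a : ℕ, M → Matrix (Fin n) (Fin (k a)) ℂ)
    (a : ℕ) (p : M) : Matrix (Fin (k a)) (Fin (k a)) ℂ :=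
  (frenet h ξ a p)ᴴ * h * frenet h ξ a p

/-- `D_{ba} = -(B_{ab})†`, used for `b + 1 = a`. -/
def coeffD (B : ∀ b a : ℕ, M → Matrix (Fin (k b)) (Fin (k a)) ℂ) (b a : ℕ) (p : M) :
    Matrix (Fin (k b)) (Fin (k a)) ℂ :=
  -(B a b p)ᴴ

/-- The construction starts with `φ_0 = ξ_0`. -/
theorem frenet_zero (h : Matrix (Fin n) (Fin n) ℂ)
    (ξ : ∀ a : ℕ, M → Matrix (Fin n) (Fin (k a)) ℂ) (p : M) : frenet h ξ 0 p = ξ 0 p := by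
  simp [frenet, projProd]

/-- The second block is `φ_1 = Π_0 ξ_1` with `Π_0 = I_n - φ_0 β_0⁻¹ φ_0† h`. -/
theorem frenet_one (h : Matrix (Fin n) (Fin n) ℂ)
    (ξ : ∀ a : ℕ, M → Matrix (Fin n) (Fin (k a)) ℂ) (p : M) :
    frenet h ξ 1 p
      = (1 - frenet h ξ 0 p * (gram h ξ 0 p)⁻¹ * (frenet h ξ 0 p)ᴴ * h) * ξ 1 p := by
  simp [frenet, gram, projProd, projector]

/-- The factors of the product are `Π_a = I_n - φ_a β_a⁻¹ φ_a† h`. -/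
theorem projProd_succ (h : Matrix (Fin n) (Fin n) ℂ)
    (ξ : ∀ a : ℕ, M → Matrix (Fin n) (Fin (k a)) ℂ) (a : ℕ) (p : M) :
    projProd h (fun b => ξ b p) (a + 1)
      = (1 - frenet h ξ a p * (gram h ξ a p)⁻¹ * (frenet h ξ a p)ᴴ * h)
        * projProd h (fun b => ξ b p) a := rfl

end Frame

end FrenetFrame

end

/-!
The product `P_a = Π_{a-1} ⋯ Π_0` is the `h`-orthogonal projection whose kernel is spanned by the
columns of `ξ_0, …, ξ_{a-1}` (`projProd_isProjection`), and it differs from the identity only by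
combinations of these columns. Hence linear independence of the blocks makes `φ_a = P_a ξ_a`
injective and `β_a` positive definite (`isUnit_gram_of_independent`). Moreover
`P_{a+1} = P_a - φ_a β_a⁻¹ φ_a† h` (`projProd_succ_eq_sub`) and `φ_a† h ξ_a = β_a`.

The differential equations follow by induction on `a` from the invariant
`∂_+P_a = ∂_+φ_a β_a⁻¹ φ_a† h`, `φ_a† h ∂_+φ_a = 0` (`PlusDerivativeInvariant`), trivial for
`a = 0`. Since `h P_a = P_a† h`, its adjoint says that `∂_-P_a` has values in the column space of
`φ_a`. As `P_a` removes `ξ_b` for `b < a` from `∂_-ξ_a = ∑ ξ_b B_{ba}`, this gives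
`∂_-φ_a = φ_a C + φ_{a+1} B_{a+1,a}` for some `C`, and pairing with `φ_a` yields `∂_-β_a = β_a C`
(`matDMinus_frenet`). Differentiating `P_{a+1} = P_a - φ_a β_a⁻¹ φ_a† h` by `∂_+`, all terms cancel
except `-φ_a β_a⁻¹ B_{a+1,a}† φ_{a+1}† h` (`matDPlus_projProd_succ`). Multiplied by the holomorphic
`ξ_{a+1}` this is the formula for `∂_+φ_{a+1}`, and with `φ_{a+1}† h φ_a = 0` it restores the
invariant at `a + 1`.
-/

namespace FrenetFrame

/-! ### Linear algebra of the iterated projections -/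

section Algebra

variable {n : ℕ} {k : ℕ → ℕ} {h : Matrix (Fin n) (Fin n) ℂ}
  {ξ : ∀ a : ℕ, Matrix (Fin n) (Fin (k a)) ℂ}

/-- For a projection `P` that is self-adjoint for `h`, and `φ = P X`, the covector matrix `φ† h`
is fixed by `P` from the right. -/
theorem conjTranspose_mul_form_mul_projection {m : ℕ} {P : Matrix (Fin n) (Fin n) ℂ}
    (hadj : h * P = Pᴴ * h) (hidem : P * P = P) (X : Matrix (Fin n) (Fin m) ℂ) :
    (P * X)ᴴ * h * P = (P * X)ᴴ * h := by
  rw [Matrix.conjTranspose_mul, Matrix.mul_assoc Xᴴ, ← hadj, Matrix.mul_assoc, Matrix.mul_assoc,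
    hidem]

/-- The Gram matrix of `φ = P X` pairs `φ` with `X` itself. -/
theorem conjTranspose_mul_form_mul_eq_gram {m : ℕ} {P : Matrix (Fin n) (Fin n) ℂ}
    (hadj : h * P = Pᴴ * h) (hidem : P * P = P) (X : Matrix (Fin n) (Fin m) ℂ) :
    (P * X)ᴴ * h * X = (P * X)ᴴ * h * (P * X) := by
  rw [← Matrix.mul_assoc, conjTranspose_mul_form_mul_projection hadj hidem]

/-- As long as the Gram matrices are invertible, `Π_{a-1} ⋯ Π_0` is the `h`-orthogonal projection
with kernel containing the columns of `ξ_0, …, ξ_{a-1}`. -/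
theorem projProd_isProjection (hh : h.IsHermitian) (a : ℕ)
    (hβ : ∀ b < a, IsUnit ((projProd h ξ b * ξ b)ᴴ * h * (projProd h ξ b * ξ b))) :
    h * projProd h ξ a = (projProd h ξ a)ᴴ * h ∧
    projProd h ξ a * projProd h ξ a = projProd h ξ a ∧
    ∀ b < a, projProd h ξ a * ξ b = 0 := by
  induction a with
  | zero => simp [projProd]
  | succ a ih =>
    obtain ⟨hadj, hidem, hker⟩ := ih fun b hb => hβ b (hb.trans a.lt_succ_self)
    have hu := hβ a a.lt_succ_self
    have hfix := conjTranspose_mul_form_mul_projection hadj hidem (ξ a)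
    have hgram := conjTranspose_mul_form_mul_eq_gram hadj hidem (ξ a)
    simp only [projProd, projector]
    set P := projProd h ξ a with hP
    set φ := P * ξ a with hφ
    set β := φᴴ * h * φ with hβdef
    have hPφ : P * φ = φ := by rw [hφ, ← Matrix.mul_assoc, hidem]
    have hdet : IsUnit β.det := (Matrix.isUnit_iff_isUnit_det β).1 hu
    have hβherm : βᴴ = β := by
      simp only [hβdef, Matrix.conjTranspose_mul, Matrix.conjTranspose_conjTranspose, hh.eq,
        Matrix.mul_assoc]
    set Q := φ * β⁻¹ * φᴴ * h with hQ
    have hQP : Q * P = Q := by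
      rw [hQ, Matrix.mul_assoc (φ * β⁻¹), Matrix.mul_assoc (φ * β⁻¹), hfix]
    have hPQ : P * Q = Q := by
      simp only [hQ, ← Matrix.mul_assoc, hPφ]
    have hQφ : Q * φ = φ := by
      have : Q * φ = φ * (β⁻¹ * β) := by simp only [hQ, hβdef, Matrix.mul_assoc]
      rw [this, Matrix.nonsing_inv_mul _ hdet, Matrix.mul_one]
    have hQQ : Q * Q = Q := by
      have : Q * Q = Q * φ * (β⁻¹ * φᴴ * h) := by simp only [hQ, Matrix.mul_assoc]
      rw [this, hQφ]; simp only [hQ, Matrix.mul_assoc]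
    have hQadj : h * Q = Qᴴ * h := by
      simp only [hQ, Matrix.conjTranspose_mul, Matrix.conjTranspose_conjTranspose, hh.eq,
        Matrix.conjTranspose_nonsing_inv, hβherm, Matrix.mul_assoc]
    have hsucc : (1 - Q) * P = P - Q := by rw [Matrix.sub_mul, Matrix.one_mul, hQP]
    rw [hsucc]
    refine ⟨?_, ?_, fun b hb => ?_⟩
    · rw [Matrix.mul_sub, hadj, hQadj, Matrix.conjTranspose_sub, Matrix.sub_mul]
    · rw [Matrix.sub_mul, Matrix.mul_sub, Matrix.mul_sub, hidem, hPQ, hQP, hQQ, sub_self, sub_zero]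
    · rcases Nat.lt_succ_iff_lt_or_eq.1 hb with hb | rfl
      · rw [Matrix.sub_mul, ← hQP, Matrix.mul_assoc, hker b hb]; simp
      · rw [Matrix.sub_mul, ← hφ, ← hQP, Matrix.mul_assoc, ← hφ, hQφ, sub_self]

/-- `Π_{a-1} ⋯ Π_0` changes a vector only by a combination of the columns of `ξ_0, …, ξ_{a-1}`. -/
theorem exists_projProd_mulVec_eq (h : Matrix (Fin n) (Fin n) ℂ)
    (ξ : ∀ a : ℕ, Matrix (Fin n) (Fin (k a)) ℂ) (a : ℕ) (x : Fin n → ℂ) :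
    ∃ c : ∀ b : ℕ, Fin (k b) → ℂ,
      projProd h ξ a *ᵥ x = x + ∑ b ∈ Finset.range a, ξ b *ᵥ c b := by
  induction a generalizing x with
  | zero => exact ⟨fun _ => 0, by simp [projProd]⟩
  | succ a ih =>
    set P := projProd h ξ a with hP
    set u : Fin (k a) → ℂ :=
      (((P * ξ a)ᴴ * h * (P * ξ a))⁻¹ * (P * ξ a)ᴴ * h * P) *ᵥ x with hu
    -- the new factor subtracts a multiple `φ_a u = P ξ_a u`, which `P` lets one move into `x`
    have key : projProd h ξ (a + 1) *ᵥ x = P *ᵥ (x - ξ a *ᵥ u) := by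
      simp only [projProd, projector, ← hP, hu, Matrix.sub_mul, Matrix.one_mul, Matrix.sub_mulVec,
        Matrix.mulVec_sub, Matrix.mulVec_mulVec, Matrix.mul_assoc]
    obtain ⟨c, hc⟩ := ih (x - ξ a *ᵥ u)
    refine ⟨Function.update c a (-u), ?_⟩
    have hsum : ∑ b ∈ Finset.range a, ξ b *ᵥ Function.update c a (-u) b
        = ∑ b ∈ Finset.range a, ξ b *ᵥ c b :=
      Finset.sum_congr rfl fun b hb => by
        rw [Function.update_of_ne (Finset.mem_range.1 hb).ne]
    rw [key, hc, Finset.sum_range_succ, hsum, Function.update_self, Matrix.mulVec_neg]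
    abel

/-- If the columns of `ξ_0, …, ξ_a` are linearly independent, then `β_a` is invertible. -/
theorem isUnit_gram_of_independent (hh : h.PosDef) (a : ℕ)
    (hind : ∀ c : ∀ b : ℕ, Fin (k b) → ℂ,
      ∑ b ∈ Finset.range (a + 1), ξ b *ᵥ c b = 0 → c a = 0) :
    IsUnit ((projProd h ξ a * ξ a)ᴴ * h * (projProd h ξ a * ξ a)) := by
  refine (hh.conjTranspose_mul_mul_same ?_).isUnit
  refine (injective_iff_map_eq_zero (projProd h ξ a * ξ a).mulVecLin).2 fun v hv => ?_
  obtain ⟨c, hc⟩ := exists_projProd_mulVec_eq h ξ a (ξ a *ᵥ v)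
  have hsum : ∑ b ∈ Finset.range a, ξ b *ᵥ Function.update c a v b
      = ∑ b ∈ Finset.range a, ξ b *ᵥ c b :=
    Finset.sum_congr rfl fun b hb => by
      rw [Function.update_of_ne (Finset.mem_range.1 hb).ne]
  have := hind (Function.update c a v) (by
    rw [Finset.sum_range_succ, hsum, Function.update_self, add_comm, ← hc, Matrix.mulVec_mulVec]
    exact hv)
  rwa [Function.update_self] at this

/-- Full column rank of `(ξ_0 ⋯ ξ_a)` as linear independence of the blocks. -/
theorem eq_zero_of_blockRow_rank {M : Type*} {ξ : ∀ a : ℕ, M → Matrix (Fin n) (Fin (k a)) ℂ}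
    {a : ℕ} {p : M} (hr : (blockRow ξ a p).rank = ∑ b ∈ Finset.range (a + 1), k b)
    (c : ∀ b : ℕ, Fin (k b) → ℂ)
    (hc : ∑ b ∈ Finset.range (a + 1), ξ b p *ᵥ c b = 0) : c a = 0 := by
  have hcard : (blockRow ξ a p).rank = Fintype.card ((b : Fin (a + 1)) × Fin (k b)) := by
    rw [hr, Fintype.card_sigma, Finset.sum_range]; simp
  have hli : LinearIndependent ℂ (blockRow ξ a p).col := by
    rw [linearIndependent_iff_card_eq_finrank_span, Set.finrank,
      ← Matrix.rank_eq_finrank_span_cols, hcard]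
  have hinj := Matrix.mulVec_injective_iff.2 hli
  have hzero : (fun j : (b : Fin (a + 1)) × Fin (k b) => c j.1 j.2) = 0 := by
    apply hinj
    rw [Matrix.mulVec_zero, ← hc, Finset.sum_range]
    ext i
    simp [Matrix.mulVec, dotProduct, blockRow, Fintype.sum_sigma, Finset.sum_apply]
  ext j
  exact congrFun hzero ⟨Fin.last a, j⟩

theorem conjTranspose_gram {M : Type*} {ξ : ∀ a : ℕ, M → Matrix (Fin n) (Fin (k a)) ℂ}
    (hh : h.IsHermitian) (a : ℕ) (p : M) :
    (gram h ξ a p)ᴴ = gram h ξ a p := by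
  simp only [gram, Matrix.conjTranspose_mul, Matrix.conjTranspose_conjTranspose, hh.eq,
    Matrix.mul_assoc]

end Algebra

/-! ### Smoothness of matrix-valued functions -/

section Smooth

variable {M : Type*} [TopologicalSpace M] {z : OpenPartialHomeomorph M ℂ} {U : Set M}
  {l m r : ℕ}

theorem SmoothInCoord.const (A : Matrix (Fin l) (Fin m) ℂ) : SmoothInCoord z U fun _ => A :=
  fun _ _ => contDiffOn_const

theorem SmoothInCoord.mul {X : M → Matrix (Fin l) (Fin m) ℂ} {Y : M → Matrix (Fin m) (Fin r) ℂ}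
    (hX : SmoothInCoord z U X) (hY : SmoothInCoord z U Y) :
    SmoothInCoord z U fun p => X p * Y p := fun i j => by
  simp only [Matrix.mul_apply]
  exact ContDiffOn.sum fun s _ => (hX i s).mul (hY s j)

theorem SmoothInCoord.sub {X Y : M → Matrix (Fin l) (Fin m) ℂ}
    (hX : SmoothInCoord z U X) (hY : SmoothInCoord z U Y) :
    SmoothInCoord z U fun p => X p - Y p :=
  fun i j => (hX i j).sub (hY i j)

theorem SmoothInCoord.conjTranspose {X : M → Matrix (Fin l) (Fin m) ℂ}
    (hX : SmoothInCoord z U X) : SmoothInCoord z U fun p => (X p)ᴴ :=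
  fun i j => Complex.conjCLE.contDiff.comp_contDiffOn (hX j i)

theorem SmoothInCoord.contDiffOn_det {X : M → Matrix (Fin m) (Fin m) ℂ}
    (hX : SmoothInCoord z U X) :
    ContDiffOn ℝ ∞ (fun w => (X (z.symm w)).det) (z '' U) := by
  simp only [Matrix.det_apply']
  exact ContDiffOn.sum fun σ _ => contDiffOn_const.mul (contDiffOn_prod fun i _ => hX _ _)

theorem SmoothInCoord.inv {X : M → Matrix (Fin m) (Fin m) ℂ} (hX : SmoothInCoord z U X)
    (hUz : U ⊆ z.source) (hu : ∀ p ∈ U, IsUnit (X p)) : SmoothInCoord z U fun p => (X p)⁻¹ := by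
  intro i j
  simp only [Matrix.inv_def, Ring.inverse_eq_inv, Matrix.smul_apply, smul_eq_mul,
    Matrix.adjugate_apply]
  refine ContDiffOn.mul (hX.contDiffOn_det.inv ?_) ?_
  · rintro _ ⟨p, hp, rfl⟩
    rw [z.left_inv (hUz hp)]
    exact ((Matrix.isUnit_iff_isUnit_det _).1 (hu p hp)).ne_zero
  · refine SmoothInCoord.contDiffOn_det (X := fun p => (X p).updateRow j (Pi.single i 1))
      fun a b => ?_
    by_cases ha : a = j
    · subst ha; simpa using contDiffOn_const
    · simpa [Matrix.updateRow_ne ha] using hX a b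

theorem SmoothInCoord.differentiableAt {X : M → Matrix (Fin l) (Fin m) ℂ}
    (hX : SmoothInCoord z U X) (hU : IsOpen U) (hUz : U ⊆ z.source) {p : M} (hp : p ∈ U)
    (i : Fin l) (j : Fin m) : DifferentiableAt ℝ (fun w : ℂ => X (z.symm w) i j) (z p) :=
  ((hX i j).contDiffAt ((z.isOpen_image_of_subset_source hU hUz).mem_nhds
    ⟨p, hp, rfl⟩)).differentiableAt (by simp)

/-- In a coordinate of the complex structure, a holomorphic function is a holomorphic function of
one complex variable. -/
theorem HolomorphicOn.differentiableOn [ChartedSpace ℂ M] [IsManifold 𝓘(ℂ) 1 M]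
    (hz : z ∈ IsManifold.maximalAtlas 𝓘(ℂ) 1 M) (hUz : U ⊆ z.source)
    {X : M → Matrix (Fin l) (Fin m) ℂ} (hX : HolomorphicOn X U) (i : Fin l) (j : Fin m) :
    DifferentiableOn ℂ (fun w : ℂ => X (z.symm w) i j) (z '' U) := by
  have hsymm : MDifferentiableOn 𝓘(ℂ) 𝓘(ℂ) z.symm z.target :=
    (contMDiffOn_symm_of_mem_maximalAtlas hz).mdifferentiableOn one_ne_zero
  have hmaps : z '' U ⊆ z.symm ⁻¹' U := by
    rintro _ ⟨p, hp, rfl⟩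
    rwa [Set.mem_preimage, z.left_inv (hUz hp)]
  have hsub : z '' U ⊆ z.target := by
    rintro _ ⟨p, hp, rfl⟩
    exact z.map_source (hUz hp)
  exact mdifferentiableOn_iff_differentiableOn.1 ((hX i j).comp (hsymm.mono hsub) hmaps)

theorem HolomorphicOn.smoothInCoord [ChartedSpace ℂ M] [IsManifold 𝓘(ℂ) 1 M]
    (hz : z ∈ IsManifold.maximalAtlas 𝓘(ℂ) 1 M) (hU : IsOpen U) (hUz : U ⊆ z.source)
    {X : M → Matrix (Fin l) (Fin m) ℂ} (hX : HolomorphicOn X U) : SmoothInCoord z U X :=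
  fun i j => ((hX.differentiableOn hz hUz i j).contDiffOn
    (z.isOpen_image_of_subset_source hU hUz)).restrict_scalars ℝ

end Smooth

/-! ### Wirtinger calculus of matrix-valued functions -/

section Wirtinger

variable {M : Type*} [TopologicalSpace M] {z : OpenPartialHomeomorph M ℂ} {U : Set M}
  {l m r : ℕ}

/-- The entrywise derivation `(∂/∂x + c ∂/∂y) / 2`, which is `∂_-` for `c = -i` and `∂_+` for
`c = i`. -/
noncomputable def matWirtinger (c : ℂ) (z : OpenPartialHomeomorph M ℂ)
    (X : M → Matrix (Fin l) (Fin m) ℂ)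
    (p : M) : Matrix (Fin l) (Fin m) ℂ :=
  Matrix.of fun i j => (fderiv ℝ (fun w : ℂ => X (z.symm w) i j) (z p) 1
    + c * fderiv ℝ (fun w : ℂ => X (z.symm w) i j) (z p) Complex.I) / 2

theorem matDMinus_eq_matWirtinger (X : M → Matrix (Fin l) (Fin m) ℂ) (p : M) :
    matDMinus z X p = matWirtinger (-Complex.I) z X p := by
  ext i j; simp [matDMinus, dMinus, matWirtinger, sub_eq_add_neg]

theorem matDPlus_eq_matWirtinger (X : M → Matrix (Fin l) (Fin m) ℂ) (p : M) :
    matDPlus z X p = matWirtinger Complex.I z X p := rfl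

theorem matWirtinger_const (c : ℂ) (A : Matrix (Fin l) (Fin m) ℂ) (p : M) :
    matWirtinger c z (fun _ => A) p = 0 := by
  ext i j; simp [matWirtinger]

theorem matWirtinger_congr (c : ℂ) (hU : IsOpen U) (hUz : U ⊆ z.source)
    {X Y : M → Matrix (Fin l) (Fin m) ℂ} (hXY : ∀ q ∈ U, X q = Y q) {p : M} (hp : p ∈ U) :
    matWirtinger c z X p = matWirtinger c z Y p := by
  ext i j
  have : (fun w : ℂ => X (z.symm w) i j) =ᶠ[nhds (z p)] fun w : ℂ => Y (z.symm w) i j := by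
    filter_upwards [(z.isOpen_image_of_subset_source hU hUz).mem_nhds ⟨p, hp, rfl⟩]
    rintro _ ⟨q, hq, rfl⟩
    rw [z.left_inv (hUz hq), hXY q hq]
  simp only [matWirtinger, Matrix.of_apply, this.fderiv_eq]

theorem matWirtinger_sub (c : ℂ) (hU : IsOpen U) (hUz : U ⊆ z.source)
    {X Y : M → Matrix (Fin l) (Fin m) ℂ} (hX : SmoothInCoord z U X) (hY : SmoothInCoord z U Y)
    {p : M} (hp : p ∈ U) :
    matWirtinger c z (fun q => X q - Y q) p = matWirtinger c z X p - matWirtinger c z Y p := by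
  ext i j
  simp only [matWirtinger, Matrix.of_apply, Matrix.sub_apply,
    fderiv_fun_sub (hX.differentiableAt hU hUz hp i j) (hY.differentiableAt hU hUz hp i j),
    sub_apply]
  ring

theorem matWirtinger_mul (c : ℂ) (hU : IsOpen U) (hUz : U ⊆ z.source)
    {X : M → Matrix (Fin l) (Fin m) ℂ} {Y : M → Matrix (Fin m) (Fin r) ℂ}
    (hX : SmoothInCoord z U X) (hY : SmoothInCoord z U Y) {p : M} (hp : p ∈ U) :
    matWirtinger c z (fun q => X q * Y q) p
      = matWirtinger c z X p * Y p + X p * matWirtinger c z Y p := by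
  ext i j
  have hx := hX.differentiableAt hU hUz hp
  have hy := hY.differentiableAt hU hUz hp
  have hfd : fderiv ℝ (fun w : ℂ => ∑ s, X (z.symm w) i s * Y (z.symm w) s j) (z p)
      = ∑ s, (X p i s • fderiv ℝ (fun w : ℂ => Y (z.symm w) s j) (z p)
        + Y p s j • fderiv ℝ (fun w : ℂ => X (z.symm w) i s) (z p)) := by
    rw [fderiv_fun_sum fun s _ => (hx i s).fun_mul (hy s j)]
    refine Finset.sum_congr rfl fun s _ => ?_
    rw [fderiv_fun_mul (hx i s) (hy s j), z.left_inv (hUz hp)]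
  simp only [matWirtinger, Matrix.of_apply, Matrix.add_apply, Matrix.mul_apply, hfd,
    sum_apply, add_apply, smul_apply,
    smul_eq_mul, Finset.mul_sum, ← Finset.sum_add_distrib, Finset.sum_div]
  exact Finset.sum_congr rfl fun s _ => by ring

theorem matWirtinger_const_mul (c : ℂ) (hU : IsOpen U) (hUz : U ⊆ z.source)
    (A : Matrix (Fin l) (Fin m) ℂ) {Y : M → Matrix (Fin m) (Fin r) ℂ}
    (hY : SmoothInCoord z U Y) {p : M} (hp : p ∈ U) :
    matWirtinger c z (fun q => A * Y q) p = A * matWirtinger c z Y p := by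
  rw [matWirtinger_mul c hU hUz (.const A) hY hp, matWirtinger_const, Matrix.zero_mul, zero_add]

theorem matWirtinger_mul_const (c : ℂ) (hU : IsOpen U) (hUz : U ⊆ z.source)
    {X : M → Matrix (Fin l) (Fin m) ℂ} (hX : SmoothInCoord z U X) (A : Matrix (Fin m) (Fin r) ℂ)
    {p : M} (hp : p ∈ U) :
    matWirtinger c z (fun q => X q * A) p = matWirtinger c z X p * A := by
  rw [matWirtinger_mul c hU hUz hX (.const A) hp, matWirtinger_const, Matrix.mul_zero, add_zero]

/-- Conjugation exchanges `∂_+` and `∂_-`. -/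
theorem matWirtinger_conjTranspose (c : ℂ) (X : M → Matrix (Fin l) (Fin m) ℂ) (p : M) :
    matWirtinger c z (fun q => (X q)ᴴ) p = (matWirtinger (star c) z X p)ᴴ := by
  ext i j
  have : fderiv ℝ (fun w : ℂ => star (X (z.symm w) j i)) (z p)
      = (starL' ℝ : ℂ ≃L[ℝ] ℂ) ∘L fderiv ℝ (fun w : ℂ => X (z.symm w) j i) (z p) :=
    fderiv_star
  simp only [matWirtinger, Matrix.of_apply, Matrix.conjTranspose_apply, this]
  simp

theorem matWirtinger_inv (c : ℂ) (hU : IsOpen U) (hUz : U ⊆ z.source)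
    {X : M → Matrix (Fin m) (Fin m) ℂ} (hX : SmoothInCoord z U X) (hu : ∀ p ∈ U, IsUnit (X p))
    {p : M} (hp : p ∈ U) :
    matWirtinger c z (fun q => (X q)⁻¹) p = -((X p)⁻¹ * matWirtinger c z X p * (X p)⁻¹) := by
  have hdet : ∀ q ∈ U, IsUnit (X q).det := fun q hq =>
    (Matrix.isUnit_iff_isUnit_det _).1 (hu q hq)
  -- differentiate `X⁻¹ X = 1`
  have hprod :
      matWirtinger c z (fun q => (X q)⁻¹) p * X p + (X p)⁻¹ * matWirtinger c z X p = 0 := by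
    rw [← matWirtinger_mul c hU hUz (hX.inv hUz hu) hX hp,
      matWirtinger_congr c hU hUz (fun q hq => Matrix.nonsing_inv_mul _ (hdet q hq)) hp,
      matWirtinger_const]
  have := congrArg (· * (X p)⁻¹) hprod
  simp only [Matrix.add_mul, Matrix.zero_mul, Matrix.mul_assoc _ (X p) (X p)⁻¹,
    Matrix.mul_nonsing_inv _ (hdet p hp), Matrix.mul_one] at this
  exact eq_neg_of_add_eq_zero_left this

/-- The Cauchy–Riemann equations: `∂_+` annihilates holomorphic functions. -/
theorem matWirtinger_I_of_holomorphicOn [ChartedSpace ℂ M] [IsManifold 𝓘(ℂ) 1 M]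
    (hz : z ∈ IsManifold.maximalAtlas 𝓘(ℂ) 1 M) (hU : IsOpen U) (hUz : U ⊆ z.source)
    {X : M → Matrix (Fin l) (Fin m) ℂ} (hX : HolomorphicOn X U) {p : M} (hp : p ∈ U) :
    matWirtinger Complex.I z X p = 0 := by
  ext i j
  have hd : DifferentiableAt ℂ (fun w : ℂ => X (z.symm w) i j) (z p) :=
    (hX.differentiableOn hz hUz i j).differentiableAt
      ((z.isOpen_image_of_subset_source hU hUz).mem_nhds ⟨p, hp, rfl⟩)
  have hI : fderiv ℂ (fun w : ℂ => X (z.symm w) i j) (z p) Complex.I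
      = Complex.I * fderiv ℂ (fun w : ℂ => X (z.symm w) i j) (z p) 1 := by
    rw [← smul_eq_mul, ← map_smul, smul_eq_mul, mul_one]
  simp only [matWirtinger, Matrix.of_apply, hd.fderiv_restrictScalars ℝ,
    ContinuousLinearMap.coe_restrictScalars', hI, ← mul_assoc, Complex.I_mul_I, Matrix.zero_apply]
  ring

theorem matDPlus_gram {n : ℕ} {k : ℕ → ℕ} {h : Matrix (Fin n) (Fin n) ℂ}
    {ξ : ∀ a : ℕ, M → Matrix (Fin n) (Fin (k a)) ℂ} (hh : h.IsHermitian) (a : ℕ) (p : M) :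
    matDPlus z (gram h ξ a) p = (matDMinus z (gram h ξ a) p)ᴴ := by
  have : gram h ξ a = fun q => (gram h ξ a q)ᴴ := funext fun q => (conjTranspose_gram hh a q).symm
  rw [matDMinus_eq_matWirtinger, matDPlus_eq_matWirtinger]
  conv_lhs => rw [this, matWirtinger_conjTranspose]
  simp

end Wirtinger

/-! ### Pointwise structure of the Frenet frame -/

section Frame

variable {M : Type*} [TopologicalSpace M] [ChartedSpace ℂ M] {n : ℕ} {k : ℕ → ℕ}
  {z : OpenPartialHomeomorph M ℂ} {U : Set M} {t : ℕ}
  {ξ : ∀ a : ℕ, M → Matrix (Fin n) (Fin (k a)) ℂ}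
  {B : ∀ b a : ℕ, M → Matrix (Fin (k b)) (Fin (k a)) ℂ}
  {h : Matrix (Fin n) (Fin n) ℂ}

theorem isUnit_gram (hosc : IsOsculatingSequence z U t k ξ B) (hh : h.PosDef) {a : ℕ}
    (ha : a ≤ t) {p : M} (hp : p ∈ U) : IsUnit (gram h ξ a p) :=
  isUnit_gram_of_independent hh a (eq_zero_of_blockRow_rank (hosc.constant_rank a ha p hp))

theorem gram_mul_inv (hosc : IsOsculatingSequence z U t k ξ B) (hh : h.PosDef) {a : ℕ}
    (ha : a ≤ t) {p : M} (hp : p ∈ U) : gram h ξ a p * (gram h ξ a p)⁻¹ = 1 :=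
  Matrix.mul_nonsing_inv _ ((Matrix.isUnit_iff_isUnit_det _).1 (isUnit_gram hosc hh ha hp))

theorem gram_inv_mul (hosc : IsOsculatingSequence z U t k ξ B) (hh : h.PosDef) {a : ℕ}
    (ha : a ≤ t) {p : M} (hp : p ∈ U) : (gram h ξ a p)⁻¹ * gram h ξ a p = 1 :=
  Matrix.nonsing_inv_mul _ ((Matrix.isUnit_iff_isUnit_det _).1 (isUnit_gram hosc hh ha hp))

theorem projProd_isProjection_of_osculating (hosc : IsOsculatingSequence z U t k ξ B)
    (hh : h.PosDef) {a : ℕ} (ha : a ≤ t + 1) {p : M} (hp : p ∈ U) :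
    h * projProd h (fun b => ξ b p) a = (projProd h (fun b => ξ b p) a)ᴴ * h ∧
    projProd h (fun b => ξ b p) a * projProd h (fun b => ξ b p) a
      = projProd h (fun b => ξ b p) a ∧
    ∀ b < a, projProd h (fun b => ξ b p) a * ξ b p = 0 :=
  projProd_isProjection hh.isHermitian a fun _ hb =>
    isUnit_gram hosc hh (Nat.lt_succ_iff.1 (hb.trans_le ha)) hp

/-- The product of the projectors is a telescoping difference of orthogonal projections onto the
column spaces of the `φ_b`. -/
theorem projProd_succ_eq_sub (hosc : IsOsculatingSequence z U t k ξ B) (hh : h.PosDef) {a : ℕ}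
    (ha : a ≤ t) {p : M} (hp : p ∈ U) :
    projProd h (fun b => ξ b p) (a + 1) = projProd h (fun b => ξ b p) a
      - frenet h ξ a p * (gram h ξ a p)⁻¹ * (frenet h ξ a p)ᴴ * h := by
  obtain ⟨hadj, hidem, -⟩ := projProd_isProjection_of_osculating hosc hh (ha.trans t.le_succ) hp
  have hfix := conjTranspose_mul_form_mul_projection hadj hidem (ξ a p)
  change (frenet h ξ a p)ᴴ * h * _ = (frenet h ξ a p)ᴴ * h at hfix
  rw [projProd_succ, Matrix.sub_mul, Matrix.one_mul, Matrix.mul_assoc _ _ h,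
    Matrix.mul_assoc _ (_ * h), hfix]

theorem frenet_conjTranspose_mul_lift (hosc : IsOsculatingSequence z U t k ξ B) (hh : h.PosDef)
    {a : ℕ} (ha : a ≤ t) {p : M} (hp : p ∈ U) :
    (frenet h ξ a p)ᴴ * h * ξ a p = gram h ξ a p := by
  obtain ⟨hadj, hidem, -⟩ := projProd_isProjection_of_osculating hosc hh (ha.trans t.le_succ) hp
  exact conjTranspose_mul_form_mul_eq_gram hadj hidem (ξ a p)

/-- Consecutive blocks are orthogonal. -/
theorem frenet_conjTranspose_mul_frenet_succ (hosc : IsOsculatingSequence z U t k ξ B)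
    (hh : h.PosDef) {a : ℕ} (ha : a ≤ t) {p : M} (hp : p ∈ U) :
    (frenet h ξ a p)ᴴ * h * frenet h ξ (a + 1) p = 0 := by
  obtain ⟨hadj, hidem, -⟩ := projProd_isProjection_of_osculating hosc hh (ha.trans t.le_succ) hp
  have hfix := conjTranspose_mul_form_mul_projection hadj hidem (ξ a p)
  change (frenet h ξ a p)ᴴ * h * _ = (frenet h ξ a p)ᴴ * h at hfix
  have hβ : (frenet h ξ a p)ᴴ * h * (frenet h ξ a p * (gram h ξ a p)⁻¹ * (frenet h ξ a p)ᴴ * h)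
      = (frenet h ξ a p)ᴴ * h := by
    have : (frenet h ξ a p)ᴴ * h * (frenet h ξ a p * (gram h ξ a p)⁻¹ * (frenet h ξ a p)ᴴ * h)
        = gram h ξ a p * (gram h ξ a p)⁻¹ * ((frenet h ξ a p)ᴴ * h) := by
      rw [gram]; simp only [Matrix.mul_assoc]
    rw [this, gram_mul_inv hosc hh ha hp, Matrix.one_mul]
  rw [frenet.eq_1 h ξ (a + 1), ← Matrix.mul_assoc, projProd_succ_eq_sub hosc hh ha hp,
    Matrix.mul_sub, hfix, hβ, sub_self, Matrix.zero_mul]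

theorem frenet_succ_conjTranspose_mul_frenet (hosc : IsOsculatingSequence z U t k ξ B)
    (hh : h.PosDef) {a : ℕ} (ha : a ≤ t) {p : M} (hp : p ∈ U) :
    (frenet h ξ (a + 1) p)ᴴ * h * frenet h ξ a p = 0 := by
  have := congrArg Matrix.conjTranspose (frenet_conjTranspose_mul_frenet_succ hosc hh ha hp)
  simpa only [Matrix.conjTranspose_mul, Matrix.conjTranspose_conjTranspose, hh.isHermitian.eq,
    Matrix.conjTranspose_zero, Matrix.mul_assoc] using this

/-- The part of `∂_-φ_a` that comes from differentiating `ξ_a`: the projection removes the blocks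
`ξ_b` with `b < a`, and only `φ_a` and `φ_{a+1}` remain. -/
theorem exists_projProd_mul_derivative (hosc : IsOsculatingSequence z U t k ξ B) (hh : h.PosDef)
    {a : ℕ} (ha : a ≤ t) {p : M} (hp : p ∈ U) :
    ∃ C : Matrix (Fin (k a)) (Fin (k a)) ℂ,
      projProd h (fun b => ξ b p) a * matDMinus z (ξ a) p = frenet h ξ a p * C
        + if a < t then frenet h ξ (a + 1) p * B (a + 1) a p else 0 := by
  obtain ⟨-, -, hker⟩ := projProd_isProjection_of_osculating hosc hh (ha.trans t.le_succ) hp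
  have hlow : ∑ b ∈ Finset.range a, projProd h (fun b => ξ b p) a * (ξ b p * B b a p) = 0 :=
    Finset.sum_eq_zero fun b hb => by
      rw [← Matrix.mul_assoc, hker b (Finset.mem_range.1 hb), Matrix.zero_mul]
  rw [hosc.derivative a ha p hp, Matrix.mul_sum]
  rcases ha.lt_or_eq with hat | rfl
  · have hset : (Finset.range (t + 1)).filter (· ≤ a + 1) = Finset.range (a + 2) := by
      ext b; simp only [Finset.mem_filter, Finset.mem_range]; omega
    have hsplit : projProd h (fun b => ξ b p) a = projProd h (fun b => ξ b p) (a + 1)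
        + frenet h ξ a p * (gram h ξ a p)⁻¹ * (frenet h ξ a p)ᴴ * h := by
      rw [projProd_succ_eq_sub hosc hh ha hp, sub_add_cancel]
    refine ⟨B a a p + (gram h ξ a p)⁻¹ * (frenet h ξ a p)ᴴ * h * (ξ (a + 1) p * B (a + 1) a p), ?_⟩
    have htop : projProd h (fun b => ξ b p) a * (ξ (a + 1) p * B (a + 1) a p)
        = frenet h ξ (a + 1) p * B (a + 1) a p + frenet h ξ a p
          * ((gram h ξ a p)⁻¹ * (frenet h ξ a p)ᴴ * h * (ξ (a + 1) p * B (a + 1) a p)) := by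
      rw [hsplit, Matrix.add_mul, frenet.eq_1 h ξ (a + 1)]
      simp only [Matrix.mul_assoc]
    rw [hset, Finset.sum_range_succ, Finset.sum_range_succ, hlow, htop, if_pos hat, zero_add,
      Matrix.mul_add, ← Matrix.mul_assoc _ (ξ a p)]
    change frenet h ξ a p * B a a p + _ = _
    abel
  · have hset : (Finset.range (a + 1)).filter (· ≤ a + 1) = Finset.range (a + 1) := by
      ext b; simp only [Finset.mem_filter, Finset.mem_range]; omega
    refine ⟨B a a p, ?_⟩
    rw [hset, Finset.sum_range_succ, hlow, if_neg (lt_irrefl a), zero_add, add_zero,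
      ← Matrix.mul_assoc]
    rfl

/-! ### Smoothness and derivatives of the Frenet frame -/

variable [IsManifold 𝓘(ℂ) 1 M]

theorem smoothInCoord_projProd (hz : z ∈ IsManifold.maximalAtlas 𝓘(ℂ) 1 M) (hU : IsOpen U)
    (hUz : U ⊆ z.source) (hosc : IsOsculatingSequence z U t k ξ B) (hh : h.PosDef) {a : ℕ}
    (ha : a ≤ t + 1) : SmoothInCoord z U fun p => projProd h (fun b => ξ b p) a := by
  induction a with
  | zero => exact .const 1
  | succ a ih =>
    have hP := ih (by omega)
    have hφ : SmoothInCoord z U (frenet h ξ a) :=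
      hP.mul ((hosc.holomorphic a (by omega)).smoothInCoord hz hU hUz)
    have hβ : SmoothInCoord z U (gram h ξ a) := (hφ.conjTranspose.mul (.const h)).mul hφ
    exact ((SmoothInCoord.const 1).sub (((hφ.mul (hβ.inv hUz fun p hp =>
      isUnit_gram hosc hh (by omega) hp)).mul hφ.conjTranspose).mul (.const h))).mul hP

theorem smoothInCoord_frenet (hz : z ∈ IsManifold.maximalAtlas 𝓘(ℂ) 1 M) (hU : IsOpen U)
    (hUz : U ⊆ z.source) (hosc : IsOsculatingSequence z U t k ξ B) (hh : h.PosDef) {a : ℕ}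
    (ha : a ≤ t) : SmoothInCoord z U (frenet h ξ a) :=
  (smoothInCoord_projProd hz hU hUz hosc hh (ha.trans t.le_succ)).mul
    ((hosc.holomorphic a ha).smoothInCoord hz hU hUz)

theorem smoothInCoord_gram (hz : z ∈ IsManifold.maximalAtlas 𝓘(ℂ) 1 M) (hU : IsOpen U)
    (hUz : U ⊆ z.source) (hosc : IsOsculatingSequence z U t k ξ B) (hh : h.PosDef) {a : ℕ}
    (ha : a ≤ t) : SmoothInCoord z U (gram h ξ a) :=
  have hφ := smoothInCoord_frenet hz hU hUz hosc hh ha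
  (hφ.conjTranspose.mul (.const h)).mul hφ

theorem matDPlus_frenet (hz : z ∈ IsManifold.maximalAtlas 𝓘(ℂ) 1 M) (hU : IsOpen U)
    (hUz : U ⊆ z.source) (hosc : IsOsculatingSequence z U t k ξ B) (hh : h.PosDef) {a : ℕ}
    (ha : a ≤ t) {p : M} (hp : p ∈ U) :
    matDPlus z (frenet h ξ a) p
      = matDPlus z (fun q => projProd h (fun b => ξ b q) a) p * ξ a p := by
  simp only [matDPlus_eq_matWirtinger]
  refine (matWirtinger_mul Complex.I hU hUz
    (smoothInCoord_projProd hz hU hUz hosc hh (ha.trans t.le_succ))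
    ((hosc.holomorphic a ha).smoothInCoord hz hU hUz) hp).trans ?_
  rw [matWirtinger_I_of_holomorphicOn hz hU hUz (hosc.holomorphic a ha) hp, Matrix.mul_zero,
    add_zero]

/-- The Leibniz rule for `β_a = φ_a† h φ_a`, for `∂_-`. -/
theorem matDMinus_gram (hz : z ∈ IsManifold.maximalAtlas 𝓘(ℂ) 1 M) (hU : IsOpen U)
    (hUz : U ⊆ z.source) (hosc : IsOsculatingSequence z U t k ξ B) (hh : h.PosDef) {a : ℕ}
    (ha : a ≤ t) {p : M} (hp : p ∈ U) :
    matDMinus z (gram h ξ a) p = (matDPlus z (frenet h ξ a) p)ᴴ * h * frenet h ξ a p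
      + (frenet h ξ a p)ᴴ * h * matDMinus z (frenet h ξ a) p := by
  have hφ := smoothInCoord_frenet hz hU hUz hosc hh ha
  simp only [matDMinus_eq_matWirtinger, matDPlus_eq_matWirtinger]
  refine (matWirtinger_mul _ hU hUz (hφ.conjTranspose.mul (.const h)) hφ hp).trans ?_
  rw [matWirtinger_mul_const _ hU hUz hφ.conjTranspose h hp, matWirtinger_conjTranspose]
  simp

/-- The invariant that propagates along the sequence: `∂_+` of the projection `Π_{a-1} ⋯ Π_0` is
carried by the block `φ_a`, and `∂_+φ_a` is orthogonal to `φ_a`. -/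
def PlusDerivativeInvariant (z : OpenPartialHomeomorph M ℂ) (h : Matrix (Fin n) (Fin n) ℂ)
    (ξ : ∀ a : ℕ, M → Matrix (Fin n) (Fin (k a)) ℂ) (a : ℕ) (p : M) : Prop :=
  matDPlus z (fun q => projProd h (fun b => ξ b q) a) p
      = matDPlus z (frenet h ξ a) p * (gram h ξ a p)⁻¹ * (frenet h ξ a p)ᴴ * h ∧
    (frenet h ξ a p)ᴴ * h * matDPlus z (frenet h ξ a) p = 0

/-- Taking adjoints in the invariant: `∂_-` of the projection `Π_{a-1} ⋯ Π_0` has its columns in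
the span of `φ_a`. -/
theorem matDMinus_projProd (hz : z ∈ IsManifold.maximalAtlas 𝓘(ℂ) 1 M) (hU : IsOpen U)
    (hUz : U ⊆ z.source) (hosc : IsOsculatingSequence z U t k ξ B) (hh : h.PosDef) {a : ℕ}
    (ha : a ≤ t) {p : M} (hp : p ∈ U) (hinv : PlusDerivativeInvariant z h ξ a p) :
    matDMinus z (fun q => projProd h (fun b => ξ b q) a) p
      = frenet h ξ a p * ((gram h ξ a p)⁻¹ * (matDPlus z (frenet h ξ a) p)ᴴ * h) := by
  have hP := smoothInCoord_projProd hz hU hUz hosc hh (ha.trans t.le_succ)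
  have hdual : h * matDMinus z (fun q => projProd h (fun b => ξ b q) a) p
      = (matDPlus z (fun q => projProd h (fun b => ξ b q) a) p)ᴴ * h := by
    rw [matDMinus_eq_matWirtinger, matDPlus_eq_matWirtinger,
      ← matWirtinger_const_mul _ hU hUz h hP hp,
      matWirtinger_congr _ hU hUz (fun q hq =>
        (projProd_isProjection_of_osculating hosc hh (ha.trans t.le_succ) hq).1) hp,
      matWirtinger_mul_const _ hU hUz hP.conjTranspose h hp, matWirtinger_conjTranspose]
    simp
  have hdet : IsUnit h.det := (Matrix.isUnit_iff_isUnit_det h).1 hh.isUnit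
  rw [hinv.1] at hdual
  have := congrArg (h⁻¹ * ·) hdual
  simpa only [Matrix.conjTranspose_mul, Matrix.conjTranspose_conjTranspose, hh.isHermitian.eq,
    Matrix.conjTranspose_nonsing_inv, conjTranspose_gram hh.isHermitian, Matrix.mul_assoc,
    Matrix.nonsing_inv_mul_cancel_left _ _ hdet] using this

/-- The `∂_-` equation, given the invariant. The coefficient of `φ_a` is found by pairing with
`φ_a`: all other contributions to `∂_-β_a` vanish by orthogonality. -/
theorem matDMinus_frenet (hz : z ∈ IsManifold.maximalAtlas 𝓘(ℂ) 1 M) (hU : IsOpen U)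
    (hUz : U ⊆ z.source) (hosc : IsOsculatingSequence z U t k ξ B) (hh : h.PosDef) {a : ℕ}
    (ha : a ≤ t) {p : M} (hp : p ∈ U) (hinv : PlusDerivativeInvariant z h ξ a p) :
    matDMinus z (frenet h ξ a) p
      = frenet h ξ a p * (gram h ξ a p)⁻¹ * matDMinus z (gram h ξ a) p
        + if a < t then frenet h ξ (a + 1) p * B (a + 1) a p else 0 := by
  obtain ⟨C, hC⟩ : ∃ C : Matrix (Fin (k a)) (Fin (k a)) ℂ,
      matDMinus z (frenet h ξ a) p = frenet h ξ a p * C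
        + if a < t then frenet h ξ (a + 1) p * B (a + 1) a p else 0 := by
    obtain ⟨C, hC⟩ := exists_projProd_mul_derivative hosc hh ha hp
    refine ⟨(gram h ξ a p)⁻¹ * (matDPlus z (frenet h ξ a) p)ᴴ * h * ξ a p + C, ?_⟩
    have hmul : matDMinus z (frenet h ξ a) p
        = matDMinus z (fun q => projProd h (fun b => ξ b q) a) p * ξ a p
          + projProd h (fun b => ξ b p) a * matDMinus z (ξ a) p := by
      simp only [matDMinus_eq_matWirtinger]
      exact matWirtinger_mul _ hU hUz
        (smoothInCoord_projProd hz hU hUz hosc hh (ha.trans t.le_succ))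
        ((hosc.holomorphic a ha).smoothInCoord hz hU hUz) hp
    rw [hmul, hC, matDMinus_projProd hz hU hUz hosc hh ha hp hinv, Matrix.mul_add, ← add_assoc]
    simp only [Matrix.mul_assoc]
  have horth : (matDPlus z (frenet h ξ a) p)ᴴ * h * frenet h ξ a p = 0 := by
    have := congrArg Matrix.conjTranspose hinv.2
    simpa only [Matrix.conjTranspose_mul, Matrix.conjTranspose_conjTranspose, hh.isHermitian.eq,
      Matrix.conjTranspose_zero, Matrix.mul_assoc] using this
  have hnext : (frenet h ξ a p)ᴴ * h
      * (if a < t then frenet h ξ (a + 1) p * B (a + 1) a p else 0) = 0 := by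
    split_ifs
    · rw [← Matrix.mul_assoc, frenet_conjTranspose_mul_frenet_succ hosc hh ha hp, Matrix.zero_mul]
    · rw [Matrix.mul_zero]
  have hβ : matDMinus z (gram h ξ a) p = gram h ξ a p * C := by
    rw [matDMinus_gram hz hU hUz hosc hh ha hp, horth, zero_add, hC, Matrix.mul_add, hnext,
      add_zero, ← Matrix.mul_assoc]
    rfl
  rw [hβ, Matrix.mul_assoc, ← Matrix.mul_assoc _ _ C, gram_inv_mul hosc hh ha hp, Matrix.one_mul,
    hC]

/-- In `∂_+` of `Π_a ⋯ Π_0` everything cancels except the term in which the derivative of `φ_a†`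
produces `φ_{a+1}†`. -/
theorem matDPlus_projProd_succ (hz : z ∈ IsManifold.maximalAtlas 𝓘(ℂ) 1 M) (hU : IsOpen U)
    (hUz : U ⊆ z.source) (hosc : IsOsculatingSequence z U t k ξ B) (hh : h.PosDef) {a : ℕ}
    (ha : a < t) {p : M} (hp : p ∈ U) (hinv : PlusDerivativeInvariant z h ξ a p) :
    matDPlus z (fun q => projProd h (fun b => ξ b q) (a + 1)) p
      = frenet h ξ a p * (gram h ξ a p)⁻¹ * coeffD B a (a + 1) p
        * (frenet h ξ (a + 1) p)ᴴ * h := by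
  have hP := smoothInCoord_projProd hz hU hUz hosc hh (ha.le.trans t.le_succ)
  have hφ := smoothInCoord_frenet hz hU hUz hosc hh ha.le
  have hβ := smoothInCoord_gram hz hU hUz hosc hh ha.le
  have hunit : ∀ q ∈ U, IsUnit (gram h ξ a q) := fun q hq => isUnit_gram hosc hh ha.le hq
  have hβinv := hβ.inv hUz hunit
  have hminus := matDMinus_frenet hz hU hUz hosc hh ha.le hp hinv
  rw [if_pos ha] at hminus
  have hexpand : matDPlus z (fun q => projProd h (fun b => ξ b q) (a + 1)) p
      = matDPlus z (fun q => projProd h (fun b => ξ b q) a) p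
        - ((matDPlus z (frenet h ξ a) p * (gram h ξ a p)⁻¹
            + frenet h ξ a p
              * -((gram h ξ a p)⁻¹ * matDPlus z (gram h ξ a) p * (gram h ξ a p)⁻¹))
            * (frenet h ξ a p)ᴴ
          + frenet h ξ a p * (gram h ξ a p)⁻¹ * (matDMinus z (frenet h ξ a) p)ᴴ) * h := by
    simp only [matDPlus_eq_matWirtinger, matDMinus_eq_matWirtinger]
    rw [matWirtinger_congr _ hU hUz
        (fun q hq => projProd_succ_eq_sub hosc hh ha.le hq) hp,
      matWirtinger_sub _ hU hUz hP
        (((hφ.mul hβinv).mul hφ.conjTranspose).mul (.const h)) hp,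
      matWirtinger_mul_const _ hU hUz ((hφ.mul hβinv).mul hφ.conjTranspose) h hp,
      matWirtinger_mul _ hU hUz (hφ.mul hβinv) hφ.conjTranspose hp,
      matWirtinger_mul _ hU hUz hφ hβinv hp,
      matWirtinger_inv _ hU hUz hβ hunit hp, matWirtinger_conjTranspose]
    simp
  rw [hexpand, hinv.1, matDPlus_gram hh.isHermitian, hminus, coeffD]
  simp only [Matrix.conjTranspose_add, Matrix.conjTranspose_mul, Matrix.conjTranspose_nonsing_inv,
    conjTranspose_gram hh.isHermitian, Matrix.add_mul, Matrix.mul_add, Matrix.mul_neg,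
    Matrix.neg_mul, Matrix.mul_assoc]
  abel

/-- The `∂_+` equation for the next block, given the invariant. -/
theorem matDPlus_frenet_succ (hz : z ∈ IsManifold.maximalAtlas 𝓘(ℂ) 1 M) (hU : IsOpen U)
    (hUz : U ⊆ z.source) (hosc : IsOsculatingSequence z U t k ξ B) (hh : h.PosDef) {a : ℕ}
    (ha : a < t) {p : M} (hp : p ∈ U) (hinv : PlusDerivativeInvariant z h ξ a p) :
    matDPlus z (frenet h ξ (a + 1)) p
      = frenet h ξ a p * (gram h ξ a p)⁻¹ * coeffD B a (a + 1) p * gram h ξ (a + 1) p := by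
  rw [matDPlus_frenet hz hU hUz hosc hh ha hp, matDPlus_projProd_succ hz hU hUz hosc hh ha hp hinv,
    ← frenet_conjTranspose_mul_lift hosc hh ha hp]
  simp only [Matrix.mul_assoc]

theorem matDPlus_frenet_zero (hz : z ∈ IsManifold.maximalAtlas 𝓘(ℂ) 1 M) (hU : IsOpen U)
    (hUz : U ⊆ z.source) (hosc : IsOsculatingSequence z U t k ξ B) (hh : h.PosDef)
    {p : M} (hp : p ∈ U) : matDPlus z (frenet h ξ 0) p = 0 := by
  rw [matDPlus_frenet hz hU hUz hosc hh t.zero_le hp, matDPlus_eq_matWirtinger]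
  simp only [projProd, matWirtinger_const, Matrix.zero_mul]

theorem plusDerivativeInvariant (hz : z ∈ IsManifold.maximalAtlas 𝓘(ℂ) 1 M) (hU : IsOpen U)
    (hUz : U ⊆ z.source) (hosc : IsOsculatingSequence z U t k ξ B) (hh : h.PosDef) {a : ℕ}
    (ha : a ≤ t) {p : M} (hp : p ∈ U) : PlusDerivativeInvariant z h ξ a p := by
  induction a with
  | zero =>
    refine ⟨?_, ?_⟩
    · rw [matDPlus_frenet_zero hz hU hUz hosc hh hp, matDPlus_eq_matWirtinger]
      simp only [projProd, matWirtinger_const, Matrix.zero_mul]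
    · rw [matDPlus_frenet_zero hz hU hUz hosc hh hp, Matrix.mul_zero]
  | succ a ih =>
    have hinv := ih (a.le_succ.trans ha)
    refine ⟨?_, ?_⟩
    · rw [matDPlus_frenet_succ hz hU hUz hosc hh ha hp hinv,
        matDPlus_projProd_succ hz hU hUz hosc hh ha hp hinv,
        Matrix.mul_assoc _ (gram h ξ (a + 1) p), gram_mul_inv hosc hh ha hp, Matrix.mul_one]
    · rw [matDPlus_frenet_succ hz hU hUz hosc hh ha hp hinv]
      simp only [← Matrix.mul_assoc,
        frenet_succ_conjTranspose_mul_frenet hosc hh (a.le_succ.trans ha) hp, Matrix.zero_mul]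

end Frame

end FrenetFrame

theorem mainTheorem1 {M : Type*} [TopologicalSpace M] [ChartedSpace ℂ M] [IsManifold 𝓘(ℂ) 1 M]
    {n : ℕ} (k : ℕ → ℕ) (ψ : M → FrenetFrame.Grassmann n (k 0))
    (hψ : FrenetFrame.IsHolomorphicCurve ψ)
    (z : OpenPartialHomeomorph M ℂ) (hz : z ∈ IsManifold.maximalAtlas 𝓘(ℂ) 1 M)
    (U : Set M) (hU : IsOpen U) (hUz : U ⊆ z.source)
    (t : ℕ) (ξ : ∀ a : ℕ, M → Matrix (Fin n) (Fin (k a)) ℂ)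
    (B : ∀ b a : ℕ, M → Matrix (Fin (k b)) (Fin (k a)) ℂ)
    (hlift : FrenetFrame.IsHolomorphicLift ψ U (ξ 0))
    (hosc : FrenetFrame.IsOsculatingSequence z U t k ξ B)
    (h : Matrix (Fin n) (Fin n) ℂ) (hh : h.PosDef) :
    -- the blocks are smooth and the matrices `β_a` are smooth and invertible, so that the
    -- derivatives and inverses below are genuine
    (∀ a ≤ t,
      FrenetFrame.SmoothInCoord z U (FrenetFrame.frenet h ξ a) ∧
      FrenetFrame.SmoothInCoord z U (FrenetFrame.gram h ξ a) ∧
      ∀ p ∈ U, IsUnit (FrenetFrame.gram h ξ a p)) ∧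
    -- `∂_-φ_a = φ_a β_a⁻¹ ∂_-β_a + φ_{a+1} B_{a+1,a}`, without the second term for `a = t`
    (∀ a < t, ∀ p ∈ U,
      FrenetFrame.matDMinus z (FrenetFrame.frenet h ξ a) p
        = FrenetFrame.frenet h ξ a p * (FrenetFrame.gram h ξ a p)⁻¹
            * FrenetFrame.matDMinus z (FrenetFrame.gram h ξ a) p
          + FrenetFrame.frenet h ξ (a + 1) p * B (a + 1) a p) ∧
    (∀ p ∈ U,
      FrenetFrame.matDMinus z (FrenetFrame.frenet h ξ t) p
        = FrenetFrame.frenet h ξ t p * (FrenetFrame.gram h ξ t p)⁻¹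
            * FrenetFrame.matDMinus z (FrenetFrame.gram h ξ t) p) ∧
    -- `∂_+φ_a = φ_{a-1} β_{a-1}⁻¹ D_{a-1,a} β_a`, with right-hand side `0` for `a = 0`
    (∀ p ∈ U, FrenetFrame.matDPlus z (FrenetFrame.frenet h ξ 0) p = 0) ∧
    (∀ a < t, ∀ p ∈ U,
      FrenetFrame.matDPlus z (FrenetFrame.frenet h ξ (a + 1)) p
        = FrenetFrame.frenet h ξ a p * (FrenetFrame.gram h ξ a p)⁻¹
            * FrenetFrame.coeffD B a (a + 1) p * FrenetFrame.gram h ξ (a + 1) p) := by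
  refine ⟨fun a ha => ⟨FrenetFrame.smoothInCoord_frenet hz hU hUz hosc hh ha,
    FrenetFrame.smoothInCoord_gram hz hU hUz hosc hh ha,
    fun p hp => FrenetFrame.isUnit_gram hosc hh ha hp⟩, fun a ha p hp => ?_, fun p hp => ?_,
    fun p hp => FrenetFrame.matDPlus_frenet_zero hz hU hUz hosc hh hp, fun a ha p hp => ?_⟩
  · rw [FrenetFrame.matDMinus_frenet hz hU hUz hosc hh ha.le hp
      (FrenetFrame.plusDerivativeInvariant hz hU hUz hosc hh ha.le hp), if_pos ha]
  · rw [FrenetFrame.matDMinus_frenet hz hU hUz hosc hh le_rfl hp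
      (FrenetFrame.plusDerivativeInvariant hz hU hUz hosc hh le_rfl hp), if_neg (lt_irrefl t),
      add_zero]
  · exact FrenetFrame.matDPlus_frenet_succ hz hU hUz hosc hh ha hp
      (FrenetFrame.plusDerivativeInvariant hz hU hUz hosc hh ha.le hp)
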